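/- **Lemma 2.3.** Let $n\in\{2,3\}$ and let $\Omega\subset\mathbb R^n$ be a bounded, convex, open set. Let $a_{ij},c_0\in L^\infty(\Omega)$ ($1\le i,j\le n$) with $a_{ij}=a_{ji}$ and $c_0\ge 0$ a.e. in $\Omega$, and suppose there is $\theta>0$ with $\sum_{i,j}a_{ij}(x)\xi_i\xi_j\ge\theta\|\xi\|^2$ for a.a. $x\in\Omega$ and all $\xi\in\mathbb R^n$. Let $Y=H^1_0(\Omega)$ and $U=L^2(\Omega)$, define $A\in\mathcal L(Y,Y^*)$ by $$(Ay)(v)=\int_\Omega\Big(\sum_{i,j=1}^n a_{ij}\,y_{x_i}v_{x_j}+c_0\,y\,v\Big)\,dx ,$$ and define $B\in\mathcal L(U,Y^*)$ by $(Bu)(v)=(u,v)_{L^2(\Omega)}$. Let $y_d,y_r\in L^2(\Omega)$, let $a\le 0\le b$ be real numbers, let $\alpha,\beta>0$, and consider the problem $$(\mathrm P)\qquad \min_{(y,u)\in Y\times U}\ \tfrac12\|y-y_d\|_{L^2(\Omega)}^2+\tfrac{\alpha}{2}\|u\|_{L^2(\Omega)}^2+\beta\|u\|_{L^1(\Omega)}\quad\text{s.t.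 } Ay=B(u+y_r),\ \ a\le u\le b\ \text{ a.e. on }\Omega .$$ Then $A$ has a bounded inverse. Put $$\beta_0:=\big\|(A^{-1})^*(y_d-A^{-1}By_r)\big\|_{L^\infty(\Omega)}\in[0,\infty],$$ where $(A^{-1})^*:Y^*\to Y^{**}=Y$ is the adjoint of $A^{-1}:Y^*\to Y$ and $f\in L^2(\Omega)$ is identified with $Bf\in Y^*$. If $\beta\ge\beta_0$, then the unique solution of $(\mathrm P)$ is $(y^*_\beta,u^*_\beta)=(A^{-1}By_r,\,0)$. -/

import Mathlib

open MeasureTheory TopologicalSpace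
open scoped ENNReal ContDiff Distributions

noncomputable section

namespace SparseControl

/-- The space `ℝⁿ` with its Euclidean norm. -/
abbrev Sp (n : ℕ) : Type := EuclideanSpace ℝ (Fin n)

variable {n : ℕ} (Ω : Opens (Sp n))

/-- Lebesgue measure on `Ω`. -/
abbrev vol : Measure (Sp n) := volume.restrict (Ω : Set (Sp n))

/-- `L²(Ω)`; this is also the control space `U`. -/
abbrev L2 : Type := Lp ℝ 2 (vol Ω)

/-- `L²(Ω; ℝⁿ)`. -/
abbrev L2Vec : Type := Lp (Sp n) 2 (vol Ω)

/-- `L^∞(Ω)`. -/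
abbrev Linf : Type := Lp ℝ ∞ (vol Ω)

/-- The Hilbert space of pairs `(y, g)` with `y ∈ L²(Ω)` and `g ∈ L²(Ω; ℝⁿ)`; its norm restricts to
the `H¹`-norm `(‖y‖² + ‖∇y‖²)^{1/2}` on the pairs `(y, ∇y)`. -/
abbrev Jet : Type := WithLp 2 (L2 Ω × L2Vec Ω)

/-- The pairs `(φ, ∇φ)` with `φ ∈ C_c^∞(Ω)`. -/
def testJets : Submodule ℝ (Jet Ω) where
  carrier := {w | ∃ φ : 𝓓(Ω, ℝ), w.fst =ᵐ[vol Ω] φ ∧ w.snd =ᵐ[vol Ω] gradient φ}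
  zero_mem' := by
    refine ⟨0, ?_, ?_⟩
    · exact Lp.coeFn_zero ℝ 2 (vol Ω)
    · have h : gradient (0 : 𝓓(Ω, ℝ)) = fun _ => (0 : Sp n) := by
        funext x
        simp [gradient, FunLike.coe_zero]
      rw [h]
      exact Lp.coeFn_zero (Sp n) 2 (vol Ω)
  add_mem' := by
    rintro v w ⟨φ, h1, h2⟩ ⟨ψ, h3, h4⟩
    refine ⟨φ + ψ, ?_, ?_⟩
    · filter_upwards [Lp.coeFn_add v.fst w.fst, h1, h3] with x hx h1 h3
      have : (v + w).fst x = (v.fst + w.fst) x := rfl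
      rw [this, hx, FunLike.coe_add, Pi.add_apply, Pi.add_apply, h1, h3]
    · filter_upwards [Lp.coeFn_add v.snd w.snd, h2, h4] with x hx h2 h4
      have : (v + w).snd x = (v.snd + w.snd) x := rfl
      rw [this, hx, Pi.add_apply, h2, h4, FunLike.coe_add]
      unfold gradient
      rw [fderiv_add (φ.contDiff.differentiable (by simp) x)
        (ψ.contDiff.differentiable (by simp) x), map_add]
  smul_mem' := by
    rintro c v ⟨φ, h1, h2⟩
    refine ⟨c • φ, ?_, ?_⟩
    · filter_upwards [Lp.coeFn_smul c v.fst, h1] with x hx h1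
      have : (c • v).fst x = (c • v.fst) x := rfl
      rw [this, hx, FunLike.coe_smul, Pi.smul_apply, Pi.smul_apply, h1]
    · filter_upwards [Lp.coeFn_smul c v.snd, h2] with x hx h2
      have : (c • v).snd x = (c • v.snd) x := rfl
      rw [this, hx, Pi.smul_apply, h2, FunLike.coe_smul]
      unfold gradient
      rw [fderiv_const_smul (φ.contDiff.differentiable (by simp) x)]
      simp

/-- The state space `Y = H₀¹(Ω)`: the closure of `C_c^∞(Ω)` with respect to the `H¹`-norm, a
function `y` being stored together with its weak gradient as the pair `(y, ∇y)`. That the second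
component is the weak gradient of the first, and is determined by it, is proved below. -/
def H10 : Submodule ℝ (Jet Ω) := (testJets Ω).topologicalClosure

instance : CompleteSpace (H10 Ω) :=
  (Submodule.isClosed_topologicalClosure (testJets Ω)).completeSpace_coe

/-- `g` is the weak gradient of `y` on `Ω`. -/
def HasWeakGradient (y : L2 Ω) (g : L2Vec Ω) : Prop :=
  ∀ φ : 𝓓(Ω, ℝ), ∀ i : Fin n,
    ∫ x in Ω, y x * gradient φ x i = -∫ x in Ω, g x i * φ x

variable {Ω}

/-- The embedding `H₀¹(Ω) → L²(Ω)`, `y ↦ y`. -/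
def val : H10 Ω →L[ℝ] L2 Ω :=
  (WithLp.fstL 2 ℝ (L2 Ω) (L2Vec Ω)).comp (H10 Ω).subtypeL

/-- The weak gradient `H₀¹(Ω) → L²(Ω; ℝⁿ)`, `y ↦ ∇y`. -/
def grad : H10 Ω →L[ℝ] L2Vec Ω :=
  (WithLp.sndL 2 ℝ (L2 Ω) (L2Vec Ω)).comp (H10 Ω).subtypeL

/-- The weak partial derivative `y ↦ y_{x_i}`. -/
def pderiv (i : Fin n) : H10 Ω →L[ℝ] L2 Ω :=
  ((EuclideanSpace.proj i : Sp n →L[ℝ] ℝ).compLpL 2 (vol Ω)).comp grad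

/-- The bilinear form `a(y, v) = ∫_Ω (∑_{i,j} a_{ij} y_{x_i} v_{x_j} + c₀ y v) dx`. -/
def form (a : Fin n → Fin n → Linf Ω) (c₀ : Linf Ω) (y v : H10 Ω) : ℝ :=
  ∫ x in Ω, ((∑ i, ∑ j, a i j x * pderiv i y x * pderiv j v x) + c₀ x * val y x * val v x)

/-- The classical gradient of a test function is its weak gradient. -/
theorem hasWeakGradient_of_test {w : Jet Ω} (hw : w ∈ testJets Ω) :
    HasWeakGradient Ω w.fst w.snd := by
  obtain ⟨ψ, h1, h2⟩ := hw
  intro φ i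
  have hg : ∀ (χ : 𝓓(Ω, ℝ)) (x : Sp n),
      gradient χ x i = fderiv ℝ χ x (EuclideanSpace.single i 1) := by
    intro χ x
    rw [← inner_gradient_left]
    simp [EuclideanSpace.inner_single_right, -inner_gradient_left]
  have dφ : Continuous fun x => fderiv ℝ φ x (EuclideanSpace.single i 1) :=
    (φ.contDiff.continuous_fderiv (by simp)).clm_apply continuous_const
  have dψ : Continuous fun x => fderiv ℝ ψ x (EuclideanSpace.single i 1) :=
    (ψ.contDiff.continuous_fderiv (by simp)).clm_apply continuous_const
  have e1 : ∫ x in Ω, w.fst x * gradient φ x i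
      = ∫ x, ψ x * fderiv ℝ φ x (EuclideanSpace.single i 1) := by
    rw [integral_congr_ae (g := fun x => ψ x * fderiv ℝ φ x (EuclideanSpace.single i 1))
      (by filter_upwards [h1] with x hx; rw [hx, hg])]
    refine setIntegral_eq_integral_of_forall_compl_eq_zero fun x hx => ?_
    rw [image_eq_zero_of_notMem_tsupport fun h => hx (ψ.tsupport_subset h), zero_mul]
  have e2 : ∫ x in Ω, w.snd x i * φ x
      = ∫ x, fderiv ℝ ψ x (EuclideanSpace.single i 1) * φ x := by
    rw [integral_congr_ae (g := fun x => fderiv ℝ ψ x (EuclideanSpace.single i 1) * φ x)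
      (by filter_upwards [h2] with x hx; rw [hx, hg])]
    refine setIntegral_eq_integral_of_forall_compl_eq_zero fun x hx => ?_
    rw [image_eq_zero_of_notMem_tsupport fun h => hx (φ.tsupport_subset h), mul_zero]
  rw [e1, e2]
  exact integral_mul_fderiv_eq_neg_fderiv_mul_of_integrable
    ((dψ.mul φ.continuous).integrable_of_hasCompactSupport φ.hasCompactSupport.mul_left)
    ((ψ.continuous.mul dφ).integrable_of_hasCompactSupport ψ.hasCompactSupport.mul_right)
    ((ψ.continuous.mul φ.continuous).integrable_of_hasCompactSupport
      ψ.hasCompactSupport.mul_right)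
    (fun x _ => ψ.contDiff.differentiable (by simp) x)
    (fun x _ => φ.contDiff.differentiable (by simp) x)

/-- The second component of an element of `H₀¹(Ω)` is the weak gradient of the first one. -/
theorem hasWeakGradient (y : H10 Ω) : HasWeakGradient Ω (val y) (grad y) := by
  have hint : ∀ (f : Sp n → ℝ), Continuous f → HasCompactSupport f → MemLp f 2 (vol Ω) :=
    fun f h1 h2 => (h1.memLp_of_hasCompactSupport h2).restrict _
  intro φ i
  have m1 : MemLp (fun x => gradient φ x i) 2 (vol Ω) := by
    have e : (fun x => gradient φ x i) = fun x => fderiv ℝ φ x (EuclideanSpace.single i 1) := by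
      funext x
      rw [← inner_gradient_left]
      simp [EuclideanSpace.inner_single_right, -inner_gradient_left]
    rw [e]
    exact hint _ ((φ.contDiff.continuous_fderiv (by simp)).clm_apply continuous_const)
      (φ.hasCompactSupport.fderiv_apply ℝ _)
  have m2 : MemLp φ 2 (vol Ω) := hint _ φ.continuous φ.hasCompactSupport
  let P : L2Vec Ω →L[ℝ] L2 Ω := (EuclideanSpace.proj i : Sp n →L[ℝ] ℝ).compLpL 2 (vol Ω)
  have k1 : ∀ g : L2 Ω, ∫ x in Ω, g x * gradient φ x i = inner ℝ g (m1.toLp _) := by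
    intro g
    rw [MeasureTheory.L2.inner_def]
    refine integral_congr_ae ?_
    filter_upwards [m1.coeFn_toLp] with x hx
    rw [hx]
    simp [mul_comm]
  have k2 : ∀ g : L2Vec Ω, ∫ x in Ω, g x i * φ x = inner ℝ (P g) (m2.toLp _) := by
    intro g
    rw [MeasureTheory.L2.inner_def]
    refine integral_congr_ae ?_
    filter_upwards [m2.coeFn_toLp,
      (EuclideanSpace.proj i : Sp n →L[ℝ] ℝ).coeFn_compLpL (p := 2) g] with x hx hx'
    rw [hx, hx']
    simp [mul_comm]
  have hcl : IsClosed {w : Jet Ω | (inner ℝ w.fst (m1.toLp _) : ℝ)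
      = -inner ℝ (P w.snd) (m2.toLp _)} := by
    have c1 : Continuous fun w : Jet Ω => w.fst := (WithLp.fstL 2 ℝ (L2 Ω) (L2Vec Ω)).continuous
    have c2 : Continuous fun w : Jet Ω => w.snd := (WithLp.sndL 2 ℝ (L2 Ω) (L2Vec Ω)).continuous
    exact isClosed_eq (c1.inner continuous_const)
      ((P.continuous.comp c2).inner continuous_const).neg
  have hsub : closure (testJets Ω : Set (Jet Ω)) ⊆ {w : Jet Ω | (inner ℝ w.fst (m1.toLp _) : ℝ)
      = -inner ℝ (P w.snd) (m2.toLp _)} := by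
    refine closure_minimal (fun w hw => ?_) hcl
    have := hasWeakGradient_of_test hw φ i
    rwa [k1, k2] at this
  rw [k1, k2]
  exact hsub y.2

/-- A function in `H₀¹(Ω)` determines its weak gradient, so `H₀¹(Ω)` is a space of functions. -/
theorem val_injective : Function.Injective (val (Ω := Ω)) := by
  refine (injective_iff_map_eq_zero _).2 fun y hy => ?_
  have hz : ∀ᵐ x ∂vol Ω, ∀ i, grad y x i = 0 := by
    refine ae_all_iff.2 fun i => ?_
    have hloc : LocallyIntegrableOn (fun x => grad y x i) (Ω : Set (Sp n)) volume := by
      have h2 : MemLp (fun x => grad y x i) 2 (vol Ω) :=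
        (EuclideanSpace.proj i : Sp n →L[ℝ] ℝ).comp_memLp (grad y)
      exact locallyIntegrableOn_of_locallyIntegrable_restrict
        (h2.locallyIntegrable (by norm_num))
    refine (ae_restrict_iff' Ω.isOpen.measurableSet).2 ?_
    refine Ω.isOpen.ae_eq_zero_of_integral_contDiff_smul_eq_zero hloc fun g hg hc hs => ?_
    have hw := hasWeakGradient y ⟨g, hg, hc, hs⟩ i
    have h0 : ∫ x in Ω, val y x * gradient g x i = 0 := by
      rw [hy]
      refine integral_eq_zero_of_ae ?_
      filter_upwards [Lp.coeFn_zero ℝ 2 (vol Ω)] with x hx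
      rw [hx]
      simp
    have h1 : ∫ x in Ω, grad y x i * g x = 0 := neg_eq_zero.1 (hw.symm.trans h0)
    rw [← h1, ← setIntegral_eq_integral_of_forall_compl_eq_zero (s := (Ω : Set (Sp n)))
      fun x hx => by
        rw [image_eq_zero_of_notMem_tsupport fun h => hx (hs h), zero_smul]]
    simp [mul_comm]
  have hg : grad y = 0 := by
    refine Lp.ext ?_
    filter_upwards [hz, Lp.coeFn_zero (Sp n) 2 (vol Ω)] with x hx h0
    rw [h0]
    ext i
    exact hx i
  refine Subtype.ext ((WithLp.ofLp_injective 2) (Prod.ext hy hg))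

theorem inner_smul_eq (f : Linf Ω) (g h : L2 Ω) :
    Integrable (fun x => f x * g x * h x) (vol Ω) ∧
      ∫ x in Ω, f x * g x * h x = inner ℝ (f • g : L2 Ω) h := by
  have e : (fun x => inner ℝ ((f • g : L2 Ω) x) (h x)) =ᵐ[vol Ω] fun x => f x * g x * h x := by
    filter_upwards [Lp.coeFn_lpSMul (r := 2) f g] with x hx
    rw [hx]
    simp [mul_comm]
  refine ⟨(L2.integrable_inner (𝕜 := ℝ) (f • g : L2 Ω) h).congr e, ?_⟩
  rw [MeasureTheory.L2.inner_def]
  exact (integral_congr_ae e).symm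

theorem form_eq (a : Fin n → Fin n → Linf Ω) (c₀ : Linf Ω) (y v : H10 Ω) :
    form a c₀ y v = (∑ i, ∑ j, inner ℝ (a i j • pderiv i y : L2 Ω) (pderiv j v))
      + inner ℝ (c₀ • val y : L2 Ω) (val v) := by
  unfold form
  rw [integral_add (integrable_finsetSum _ fun i _ => integrable_finsetSum _ fun j _ =>
      (inner_smul_eq _ _ _).1) (inner_smul_eq _ _ _).1,
    integral_finsetSum _ fun i _ => integrable_finsetSum _ fun j _ => (inner_smul_eq _ _ _).1,
    (inner_smul_eq _ _ _).2]
  congr 1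
  refine Finset.sum_congr rfl fun i _ => ?_
  rw [integral_finsetSum _ fun j _ => (inner_smul_eq _ _ _).1]
  exact Finset.sum_congr rfl fun j _ => (inner_smul_eq _ _ _).2

theorem smul_smul_L2 (f : Linf Ω) (c : ℝ) (g : L2 Ω) :
    (f • (c • g) : L2 Ω) = c • (f • g : L2 Ω) := by
  rw [Lp.smul_def, Lp.smul_def]
  exact ContinuousLinearMap.holder_smul_right (ContinuousLinearMap.lsmul ℝ ℝ) c f g

theorem smul_add_L2 (f : Linf Ω) (g h : L2 Ω) :
    (f • (g + h) : L2 Ω) = (f • g : L2 Ω) + (f • h : L2 Ω) :=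
  Lp.add_smul f g h

theorem form_bound (a : Fin n → Fin n → Linf Ω) (c₀ : Linf Ω) (y v : H10 Ω) :
    ‖form a c₀ y v‖ ≤ ((∑ i, ∑ j, ‖a i j‖ * ‖pderiv (Ω := Ω) i‖ * ‖pderiv (Ω := Ω) j‖)
      + ‖c₀‖ * ‖val (Ω := Ω)‖ * ‖val (Ω := Ω)‖) * ‖y‖ * ‖v‖ := by
  have key : ∀ (f : Linf Ω) (S T : H10 Ω →L[ℝ] L2 Ω),
      ‖(inner ℝ (f • S y : L2 Ω) (T v) : ℝ)‖ ≤ ‖f‖ * ‖S‖ * ‖T‖ * ‖y‖ * ‖v‖ := by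
    intro f S T
    calc ‖(inner ℝ (f • S y : L2 Ω) (T v) : ℝ)‖ ≤ ‖(f • S y : L2 Ω)‖ * ‖T v‖ := norm_inner_le_norm _ _
      _ ≤ (‖f‖ * (‖S‖ * ‖y‖)) * (‖T‖ * ‖v‖) := by
        gcongr
        · exact (Lp.norm_smul_le f (S y)).trans (by gcongr; exact S.le_opNorm y)
        · exact T.le_opNorm v
      _ = _ := by ring
  rw [form_eq, add_mul, add_mul, Finset.sum_mul, Finset.sum_mul]
  refine (norm_add_le _ _).trans (add_le_add ((norm_sum_le _ _).trans ?_) (key _ _ _))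
  refine Finset.sum_le_sum fun i _ => ?_
  rw [Finset.sum_mul, Finset.sum_mul]
  exact (norm_sum_le _ _).trans (Finset.sum_le_sum fun j _ => key _ _ _)

/-- The operator `A ∈ 𝓛(Y, Y*)`, `A y = a(y, ·)`. -/
def opA (a : Fin n → Fin n → Linf Ω) (c₀ : Linf Ω) : H10 Ω →L[ℝ] StrongDual ℝ (H10 Ω) :=
  LinearMap.mkContinuous₂
    (LinearMap.mk₂ ℝ (form a c₀)
      (fun y y' v => by
        simp only [form_eq, map_add, smul_add_L2, inner_add_left, Finset.sum_add_distrib]; ring)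
      (fun c y v => by
        simp only [form_eq, map_smul, smul_smul_L2, real_inner_smul_left, smul_eq_mul, mul_add,
          Finset.mul_sum])
      (fun y v v' => by
        simp only [form_eq, map_add, inner_add_right, Finset.sum_add_distrib]; ring)
      (fun c y v => by
        simp only [form_eq, map_smul, real_inner_smul_right, smul_eq_mul, mul_add,
          Finset.mul_sum]))
    _ (form_bound a c₀)

/-- The operator `B ∈ 𝓛(U, Y*)`, `B u = (u, ·)_{L²(Ω)}`. -/
def opB : L2 Ω →L[ℝ] StrongDual ℝ (H10 Ω) :=
  LinearMap.mkContinuous₂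
    (LinearMap.mk₂ ℝ (fun (u : L2 Ω) (v : H10 Ω) => (inner ℝ u (val v) : ℝ))
      (fun u u' v => inner_add_left _ _ _)
      (fun c u v => real_inner_smul_left _ _ _)
      (fun u v v' => by simp only [map_add, inner_add_right])
      (fun c u v => by simp only [map_smul, real_inner_smul_right, smul_eq_mul]))
    ‖val (Ω := Ω)‖ (fun u v => by
      refine (norm_inner_le_norm (𝕜 := ℝ) u (val v)).trans ?_
      calc ‖u‖ * ‖val v‖ ≤ ‖u‖ * (‖val (Ω := Ω)‖ * ‖v‖) := by gcongr; exact val.le_opNorm v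
        _ = _ := by ring)

/-- The adjoint `T* : Y* → Y** = Y` of an operator `T : Y* → Y` on the dual of a Hilbert space `Y`.
The functional `v ↦ f (T ⟪v, ·⟫)` is represented by its Riesz vector; `adjointOfDual_spec` is the
defining property `g (T* f) = f (T g)`. -/
def adjointOfDual {Y : Type*} [NormedAddCommGroup Y] [InnerProductSpace ℝ Y] [CompleteSpace Y]
    (T : StrongDual ℝ Y →L[ℝ] Y) (f : StrongDual ℝ Y) : Y :=
  (InnerProductSpace.toDual ℝ Y).symm
    { toFun := fun v => f (T (InnerProductSpace.toDual ℝ Y v))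
      map_add' := fun v w => by simp only [map_add]
      map_smul' := fun c v => by simp
      cont := f.continuous.comp (T.continuous.comp (InnerProductSpace.toDual ℝ Y).continuous) }

theorem adjointOfDual_spec {Y : Type*} [NormedAddCommGroup Y] [InnerProductSpace ℝ Y]
    [CompleteSpace Y] (T : StrongDual ℝ Y →L[ℝ] Y) (f g : StrongDual ℝ Y) :
    g (adjointOfDual T f) = f (T g) := by
  obtain ⟨v, rfl⟩ := (InnerProductSpace.toDual ℝ Y).surjective g
  rw [InnerProductSpace.toDual_apply_apply, real_inner_comm, adjointOfDual,
    InnerProductSpace.toDual_symm_apply]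
  rfl

/-- The admissible set `U_ad = {u ∈ U | lo ≤ u ≤ hi a.e. on Ω}`. -/
def Uad (lo hi : ℝ) : Set (L2 Ω) := {u | ∀ᵐ x ∂vol Ω, lo ≤ u x ∧ u x ≤ hi}

/-- The cost `J(y, u) = ½ ‖y - y_d‖²_{L²} + (α/2) ‖u‖²_{L²} + β ‖u‖_{L¹}`. -/
def cost (yd : L2 Ω) (α β : ℝ) (y : H10 Ω) (u : L2 Ω) : ℝ :=
  1 / 2 * ‖val y - yd‖ ^ 2 + α / 2 * ‖u‖ ^ 2 + β * ∫ x in Ω, |u x|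

/-- The feasible pairs `(y, u) ∈ Y × U`: `y` is the weak solution of `L y = u + y_r` in `Ω`, `y = 0`
on `∂Ω`, that is `A y = B (u + y_r)`, and `u ∈ U_ad`. -/
def feasible (a : Fin n → Fin n → Linf Ω) (c₀ : Linf Ω) (yr : L2 Ω) (lo hi : ℝ) :
    Set (H10 Ω × L2 Ω) :=
  {w | opA a c₀ w.1 = opB (w.2 + yr) ∧ w.2 ∈ Uad lo hi}

/-- `(y, u)` is a (global) solution of the optimal control problem: it is feasible and minimizes the
cost among all feasible pairs. -/
def IsSolution (a : Fin n → Fin n → Linf Ω) (c₀ : Linf Ω) (yd yr : L2 Ω) (lo hi α β : ℝ)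
    (w : H10 Ω × L2 Ω) : Prop :=
  w ∈ feasible a c₀ yr lo hi ∧
    ∀ w' ∈ feasible a c₀ yr lo hi, cost yd α β w.1 w.2 ≤ cost yd α β w'.1 w'.2

/-- The state `A⁻¹ B y_r` that belongs to the control `0`. (`ContinuousLinearMap.inverse` is the
inverse whenever `A` is invertible.) -/
def uncontrolledState (a : Fin n → Fin n → Linf Ω) (c₀ : Linf Ω) (yr : L2 Ω) : H10 Ω :=
  (opA a c₀).inverse (opB yr)

/-- `β₀ = ‖(A⁻¹)* (y_d - A⁻¹ B y_r)‖_{L^∞(Ω)}`, a value in `[0, ∞]`; the function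
`y_d - A⁻¹ B y_r ∈ L²(Ω)` is regarded as the functional `B (y_d - A⁻¹ B y_r) ∈ Y*`. -/
def beta0 (a : Fin n → Fin n → Linf Ω) (c₀ : Linf Ω) (yd yr : L2 Ω) : ℝ≥0∞ :=
  eLpNorm (val (adjointOfDual (opA a c₀).inverse (opB (yd - val (uncontrolledState a c₀ yr)))))
    ∞ (vol Ω)

end SparseControl

end

/-! Integrating `f²` by parts against the linear function `x ↦ ⟪e, x⟫` gives Poincaré's inequality
on every domain that is bounded in the direction `e`. Hence `A` is coercive, and the Lax–Milgram
theorem inverts it.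

Let `y₀ = A⁻¹ B y_r`, let `p = (A⁻¹)* B (y_d - y₀)`, and let `(y₀ + z, u)` be feasible, so that
`A z = B u`. The cross term of the expanded cost is `⟪y_d - y₀, z⟫ = ⟪u, p⟫ ≤ ‖p‖_{L^∞} ‖u‖_{L¹}`,
which the term `β ‖u‖_{L¹}` absorbs as soon as `β ≥ β₀ = ‖p‖_{L^∞}`. The cost thus exceeds that of
`(y₀, 0)` by at least `(α/2) ‖u‖²`.
-/

namespace SparseControl

section DirectionalPoincare

theorem integrable_sq_of_hasCompactSupport {X : Type*} [TopologicalSpace X] [MeasurableSpace X]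
    [OpensMeasurableSpace X] {μ : Measure X} [IsFiniteMeasureOnCompacts μ] {f : X → ℝ}
    (hf : Continuous f) (hc : HasCompactSupport f) : Integrable (fun x => f x ^ 2) μ :=
  (by fun_prop : Continuous fun x => f x ^ 2).integrable_of_hasCompactSupport
    (hc.comp_left (g := fun t => t ^ 2) (zero_pow two_ne_zero))

variable {E : Type*} [NormedAddCommGroup E] [NormedSpace ℝ E] [FiniteDimensional ℝ E]
  [MeasurableSpace E] [BorelSpace E] {μ : Measure E} [μ.IsAddHaarMeasure]
  {f : E → ℝ} {ℓ : StrongDual ℝ E} {v : E}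

theorem integral_sq_eq_neg_integral_fderiv_mul (hf : ContDiff ℝ 1 f) (hc : HasCompactSupport f)
    (hv : ℓ v = 1) :
    ∫ x, f x ^ 2 ∂μ = -∫ x, 2 * f x * fderiv ℝ f x v * ℓ x ∂μ := by
  have hf_diff : Differentiable ℝ f := hf.differentiable one_ne_zero
  have hf_cont : Continuous f := hf.continuous
  have hderiv_cont : Continuous fun x => fderiv ℝ f x v :=
    (hf.continuous_fderiv one_ne_zero).clm_apply continuous_const
  have hfderiv_sq : ∀ x, fderiv ℝ (fun x => f x ^ 2) x v = 2 * f x * fderiv ℝ f x v := fun x => by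
    simp [fderiv_fun_pow 2 (hf_diff x)]
  have hderiv_mul_int : Integrable (fun x => 2 * f x * fderiv ℝ f x v * ℓ x) μ :=
    (((continuous_const.mul hf_cont).mul hderiv_cont).mul
      ℓ.continuous).integrable_of_hasCompactSupport hc.mul_left.mul_right.mul_right
  have hmul_int : Integrable (fun x => f x ^ 2 * ℓ x) μ :=
    ((hf_cont.pow 2).mul ℓ.continuous).integrable_of_hasCompactSupport
      (hc.comp_left (g := fun t => t ^ 2) (zero_pow two_ne_zero)).mul_right
  have hparts := integral_mul_fderiv_eq_neg_fderiv_mul_of_integrable (μ := μ)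
    (f := fun x => f x ^ 2) (g := ℓ) (v := v) (by simpa only [hfderiv_sq] using hderiv_mul_int)
    (by simpa only [ContinuousLinearMap.fderiv, hv, mul_one] using
      integrable_sq_of_hasCompactSupport hf_cont hc)
    hmul_int (fun x _ => (hf_diff x).fun_pow 2) (fun _ _ => ℓ.differentiableAt)
  simpa only [ContinuousLinearMap.fderiv, hv, mul_one, hfderiv_sq] using hparts

theorem integral_sq_le_integral_fderiv_sq (hf : ContDiff ℝ 1 f) (hc : HasCompactSupport f)
    (hv : ℓ v = 1) {R : ℝ} (hR : ∀ x ∈ Function.support f, |ℓ x| ≤ R) :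
    ∫ x, f x ^ 2 ∂μ ≤ (2 * R) ^ 2 * ∫ x, fderiv ℝ f x v ^ 2 ∂μ := by
  have hf_int := (integrable_sq_of_hasCompactSupport (μ := μ) hf.continuous hc).const_mul (1 / 2)
  have hfderiv_int := (integrable_sq_of_hasCompactSupport (μ := μ)
    ((hf.continuous_fderiv one_ne_zero).clm_apply continuous_const)
    (hc.fderiv_apply ℝ v)).const_mul (2 * R ^ 2)
  -- Young's inequality, weighted so that half of `∫ f²` is absorbed on the left.
  have hyoung : ∀ x, ‖2 * f x * fderiv ℝ f x v * ℓ x‖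
      ≤ 1 / 2 * f x ^ 2 + 2 * R ^ 2 * fderiv ℝ f x v ^ 2 := fun x => by
    by_cases hx : f x = 0
    · simp only [hx, mul_zero, zero_mul, norm_zero]
      positivity
    calc ‖2 * f x * fderiv ℝ f x v * ℓ x‖ = 2 * |f x| * |fderiv ℝ f x v| * |ℓ x| := by
          simp only [Real.norm_eq_abs, abs_mul, abs_two]
      _ ≤ 2 * |f x| * |fderiv ℝ f x v| * R := by gcongr; exact hR x hx
      _ ≤ 1 / 2 * |f x| ^ 2 + 2 * R ^ 2 * |fderiv ℝ f x v| ^ 2 := by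
          linarith [sq_nonneg (|f x| - 2 * R * |fderiv ℝ f x v|)]
      _ = 1 / 2 * f x ^ 2 + 2 * R ^ 2 * fderiv ℝ f x v ^ 2 := by simp only [sq_abs]
  have habsorb : ∫ x, f x ^ 2 ∂μ
      ≤ 1 / 2 * ∫ x, f x ^ 2 ∂μ + 2 * R ^ 2 * ∫ x, fderiv ℝ f x v ^ 2 ∂μ := by
    calc ∫ x, f x ^ 2 ∂μ = -∫ x, 2 * f x * fderiv ℝ f x v * ℓ x ∂μ :=
          integral_sq_eq_neg_integral_fderiv_mul hf hc hv
      _ ≤ ‖∫ x, 2 * f x * fderiv ℝ f x v * ℓ x ∂μ‖ := neg_le_abs _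
      _ ≤ ∫ x, (1 / 2 * f x ^ 2 + 2 * R ^ 2 * fderiv ℝ f x v ^ 2) ∂μ :=
          norm_integral_le_of_norm_le (hf_int.add hfderiv_int) (.of_forall hyoung)
      _ = 1 / 2 * ∫ x, f x ^ 2 ∂μ + 2 * R ^ 2 * ∫ x, fderiv ℝ f x v ^ 2 ∂μ := by
          rw [integral_add hf_int hfderiv_int, integral_const_mul, integral_const_mul]
  linarith

end DirectionalPoincare

section L2

variable {X : Type*} [MeasurableSpace X] {μ : Measure X}

theorem norm_sq_eq_integral_norm_sq {E : Type*} [NormedAddCommGroup E] [InnerProductSpace ℝ E]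
    (f : Lp E 2 μ) : ‖f‖ ^ 2 = ∫ x, ‖f x‖ ^ 2 ∂μ := by
  simp only [← real_inner_self_eq_norm_sq, L2.inner_def]

theorem inner_le_mul_integral_abs {u p : Lp ℝ 2 μ} (hu : Integrable u μ) {β : ℝ} (hβ : 0 ≤ β)
    (hp : eLpNorm p ∞ μ ≤ ENNReal.ofReal β) : inner ℝ u p ≤ β * ∫ x, |u x| ∂μ := by
  have hp_le : ∀ᵐ x ∂μ, ‖p x‖ ≤ β := by
    filter_upwards [enorm_ae_le_eLpNormEssSup p μ] with x hx
    rw [← eLpNorm_exponent_top] at hx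
    simpa only [← ofReal_norm, ENNReal.ofReal_le_ofReal_iff hβ] using hx.trans hp
  rw [L2.inner_def, ← integral_const_mul]
  refine integral_mono_ae (L2.integrable_inner u p) (hu.abs.const_mul β) ?_
  filter_upwards [hp_le] with x hx
  calc inner ℝ (u x) (p x) ≤ ‖u x‖ * ‖p x‖ := real_inner_le_norm _ _
    _ ≤ ‖u x‖ * β := by gcongr
    _ = β * |u x| := by rw [Real.norm_eq_abs, mul_comm]

end L2

theorem isInvertible_of_isCoercive {V : Type*} [NormedAddCommGroup V] [InnerProductSpace ℝ V]
    [CompleteSpace V] {T : V →L[ℝ] StrongDual ℝ V} (hT : IsCoercive T) : T.IsInvertible := by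
  refine ⟨hT.continuousLinearEquivOfBilin.trans
    (InnerProductSpace.toDual ℝ V).toContinuousLinearEquiv, ?_⟩
  ext v w
  exact hT.continuousLinearEquivOfBilin_apply v w

variable {n : ℕ} {Ω : Opens (Sp n)}

section Coercivity

theorem norm_fst_sq_le_norm_snd_sq_of_mem_testJets {e : Sp n} (he : ‖e‖ = 1) {R : ℝ}
    (hR : ∀ x ∈ Ω, |inner ℝ e x| ≤ R) {w : Jet Ω} (hw : w ∈ testJets Ω) :
    ‖w.fst‖ ^ 2 ≤ (2 * R) ^ 2 * ‖w.snd‖ ^ 2 := by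
  obtain ⟨φ, hφ, hgrad⟩ := hw
  have hsupp : Function.support φ ⊆ Ω := (subset_tsupport φ).trans φ.tsupport_subset
  have hsupp' : Function.support (fun x => fderiv ℝ φ x e) ⊆ Ω :=
    (subset_tsupport _).trans ((tsupport_fderiv_apply_subset ℝ e).trans φ.tsupport_subset)
  have hfst : ‖w.fst‖ ^ 2 = ∫ x, φ x ^ 2 := by
    rw [norm_sq_eq_integral_norm_sq, integral_congr_ae (g := fun x => φ x ^ 2)
      (by filter_upwards [hφ] with x hx; rw [hx, Real.norm_eq_abs, sq_abs])]
    exact setIntegral_eq_integral_of_forall_compl_eq_zero fun x hx => by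
      rw [Function.notMem_support.1 fun h => hx (hsupp h), zero_pow two_ne_zero]
  have hsnd : ∫ x, fderiv ℝ φ x e ^ 2 ≤ ‖w.snd‖ ^ 2 := by
    rw [norm_sq_eq_integral_norm_sq,
      ← setIntegral_eq_integral_of_forall_compl_eq_zero (s := (Ω : Set (Sp n))) fun x hx => by
        rw [Function.notMem_support.1 fun h => hx (hsupp' h), zero_pow two_ne_zero]]
    refine integral_mono_of_nonneg (.of_forall fun x => sq_nonneg _)
      ((Lp.memLp w.snd).integrable_norm_pow two_ne_zero) ?_
    filter_upwards [hgrad] with x hx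
    rw [hx, ← inner_gradient_left]
    simpa only [he, mul_one, sq_abs] using
      pow_le_pow_left₀ (abs_nonneg _) (abs_real_inner_le_norm (gradient φ x) e) 2
  have he' : innerSL ℝ e e = 1 := by simp [he]
  calc ‖w.fst‖ ^ 2 = ∫ x, φ x ^ 2 := hfst
    _ ≤ (2 * R) ^ 2 * ∫ x, fderiv ℝ φ x e ^ 2 :=
        integral_sq_le_integral_fderiv_sq (φ.contDiff.of_le (by simp)) φ.hasCompactSupport he'
          fun x hx => hR x (hsupp hx)
    _ ≤ (2 * R) ^ 2 * ‖w.snd‖ ^ 2 := by gcongr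

theorem norm_val_sq_le_norm_grad_sq {e : Sp n} (he : ‖e‖ = 1) {R : ℝ}
    (hR : ∀ x ∈ Ω, |inner ℝ e x| ≤ R) (y : H10 Ω) : ‖val y‖ ^ 2 ≤ (2 * R) ^ 2 * ‖grad y‖ ^ 2 := by
  have hclosed : IsClosed {w : Jet Ω | ‖w.fst‖ ^ 2 ≤ (2 * R) ^ 2 * ‖w.snd‖ ^ 2} :=
    isClosed_le ((WithLp.fstL 2 ℝ (L2 Ω) (L2Vec Ω)).continuous.norm.pow 2)
      (((WithLp.sndL 2 ℝ (L2 Ω) (L2Vec Ω)).continuous.norm.pow 2).const_mul _)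
  exact closure_minimal (fun _ => norm_fst_sq_le_norm_snd_sq_of_mem_testJets he hR) hclosed y.2

theorem norm_sq_eq_norm_val_sq_add_norm_grad_sq (y : H10 Ω) :
    ‖y‖ ^ 2 = ‖val y‖ ^ 2 + ‖grad y‖ ^ 2 :=
  WithLp.prod_norm_sq_eq_of_L2 (y : Jet Ω)

theorem pderiv_apply_ae_eq (y : H10 Ω) : ∀ᵐ x ∂vol Ω, ∀ i, pderiv i y x = grad y x i :=
  ae_all_iff.2 fun i => (EuclideanSpace.proj i : Sp n →L[ℝ] ℝ).coeFn_compLpL (grad y)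

variable {a : Fin n → Fin n → Linf Ω} {c₀ : Linf Ω} {θ : ℝ}

theorem mul_norm_grad_sq_le_form (hc₀ : ∀ᵐ x ∂vol Ω, 0 ≤ c₀ x)
    (ha_ell : ∀ᵐ x ∂vol Ω, ∀ ξ : Sp n, θ * ‖ξ‖ ^ 2 ≤ ∑ i, ∑ j, a i j x * ξ i * ξ j)
    (y : H10 Ω) : θ * ‖grad y‖ ^ 2 ≤ form a c₀ y y := by
  rw [norm_sq_eq_integral_norm_sq, ← integral_const_mul]
  refine integral_mono_ae (((Lp.memLp (grad y)).integrable_norm_pow two_ne_zero).const_mul θ)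
    ((integrable_finsetSum _ fun i _ => integrable_finsetSum _ fun j _ =>
      (inner_smul_eq _ _ _).1).add (inner_smul_eq _ _ _).1) ?_
  filter_upwards [hc₀, ha_ell, pderiv_apply_ae_eq y] with x hc₀_x hell_x hpderiv
  simp only [hpderiv]
  have hpotential : 0 ≤ c₀ x * val y x * val y x := by
    rw [mul_assoc]
    exact mul_nonneg hc₀_x (mul_self_nonneg _)
  linarith [hell_x (grad y x)]

theorem isCoercive_opA {e : Sp n} (he : ‖e‖ = 1)
    (hΩ : Bornology.IsBounded (inner ℝ e '' (Ω : Set (Sp n))))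
    (hc₀ : ∀ᵐ x ∂vol Ω, 0 ≤ c₀ x) (hθ : 0 < θ)
    (ha_ell : ∀ᵐ x ∂vol Ω, ∀ ξ : Sp n, θ * ‖ξ‖ ^ 2 ≤ ∑ i, ∑ j, a i j x * ξ i * ξ j) :
    IsCoercive (opA a c₀) := by
  obtain ⟨R, hR⟩ := hΩ.exists_norm_le
  refine ⟨θ / (1 + (2 * R) ^ 2), by positivity, fun y => ?_⟩
  have hnorm : ‖y‖ ^ 2 ≤ (1 + (2 * R) ^ 2) * ‖grad y‖ ^ 2 := by
    linarith [norm_sq_eq_norm_val_sq_add_norm_grad_sq y,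
      norm_val_sq_le_norm_grad_sq he (fun x hx => hR _ (Set.mem_image_of_mem _ hx)) y]
  calc θ / (1 + (2 * R) ^ 2) * ‖y‖ * ‖y‖ = θ / (1 + (2 * R) ^ 2) * ‖y‖ ^ 2 := by ring
    _ ≤ θ / (1 + (2 * R) ^ 2) * ((1 + (2 * R) ^ 2) * ‖grad y‖ ^ 2) := by gcongr
    _ = θ * ‖grad y‖ ^ 2 := by field_simp
    _ ≤ form a c₀ y y := mul_norm_grad_sq_le_form hc₀ ha_ell y

end Coercivity

section OptimalControl

variable {a : Fin n → Fin n → Linf Ω} {c₀ : Linf Ω} {yd yr : L2 Ω} {α β : ℝ}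

/-- The adjoint state `p = (A⁻¹)* (y_d - A⁻¹ B y_r)` at the control `0`, whose `L^∞`-norm is `β₀`.
As in `beta0`, the function `y_d - A⁻¹ B y_r` is regarded as a functional through `B`. -/
noncomputable def adjointState (a : Fin n → Fin n → Linf Ω) (c₀ : Linf Ω) (yd yr : L2 Ω) :
    H10 Ω :=
  adjointOfDual (opA a c₀).inverse (opB (yd - val (uncontrolledState a c₀ yr)))

theorem inner_val_adjointState (u : L2 Ω) :
    inner ℝ u (val (adjointState a c₀ yd yr)) =
      inner ℝ (yd - val (uncontrolledState a c₀ yr)) (val ((opA a c₀).inverse (opB u))) :=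
  adjointOfDual_spec (opA a c₀).inverse _ (opB u)

theorem opA_eq_opB_add_iff (hA : (opA a c₀).IsInvertible) {y : H10 Ω} {u : L2 Ω} :
    opA a c₀ y = opB (u + yr) ↔
      y = uncontrolledState a c₀ yr + (opA a c₀).inverse (opB u) := by
  rw [uncontrolledState, ← map_add, ← map_add, add_comm yr, eq_comm, ← hA.inverse_apply_eq,
    eq_comm]

theorem cost_add (y z : H10 Ω) (u : L2 Ω) :
    cost yd α β (y + z) u = cost yd α β y 0 - inner ℝ (yd - val y) (val z)
      + 1 / 2 * ‖val z‖ ^ 2 + α / 2 * ‖u‖ ^ 2 + β * ∫ x in Ω, |u x| := by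
  have hexpand : ‖val (y + z) - yd‖ ^ 2
      = ‖val y - yd‖ ^ 2 - 2 * inner ℝ (yd - val y) (val z) + ‖val z‖ ^ 2 := by
    rw [map_add, add_sub_right_comm, norm_add_sq_real, ← neg_sub yd (val y), inner_neg_left]
    ring
  have hL1_zero : ∫ x in Ω, |(0 : L2 Ω) x| = 0 := by
    refine integral_eq_zero_of_ae ?_
    filter_upwards [Lp.coeFn_zero ℝ 2 (vol Ω)] with x hx
    rw [hx, Pi.zero_apply, abs_zero]
  rw [cost, cost, hexpand, hL1_zero, norm_zero]
  ring

variable [IsFiniteMeasure (vol Ω)]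

theorem cost_uncontrolledState_add_le (hA : (opA a c₀).IsInvertible) (hβ : 0 ≤ β)
    (hβ₀ : beta0 a c₀ yd yr ≤ ENNReal.ofReal β) {y : H10 Ω} {u : L2 Ω}
    (hyu : opA a c₀ y = opB (u + yr)) :
    cost yd α β (uncontrolledState a c₀ yr) 0 + α / 2 * ‖u‖ ^ 2 ≤ cost yd α β y u := by
  have hu : Integrable u (vol Ω) := (Lp.memLp u).integrable one_le_two
  have hcross := inner_le_mul_integral_abs (p := val (adjointState a c₀ yd yr)) hu hβ hβ₀
  rw [inner_val_adjointState] at hcross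
  rw [(opA_eq_opB_add_iff hA).1 hyu, cost_add]
  linarith [sq_nonneg ‖val ((opA a c₀).inverse (opB u))‖]

theorem isSolution_iff_eq_uncontrolledState {lo hi : ℝ} (hA : (opA a c₀).IsInvertible)
    (hlo : lo ≤ 0) (hhi : 0 ≤ hi) (hα : 0 < α) (hβ : 0 ≤ β)
    (hβ₀ : beta0 a c₀ yd yr ≤ ENNReal.ofReal β) {w : H10 Ω × L2 Ω} :
    IsSolution a c₀ yd yr lo hi α β w ↔ w = (uncontrolledState a c₀ yr, 0) := by
  have hstate : ∀ y, opA a c₀ y = opB (0 + yr) ↔ y = uncontrolledState a c₀ yr := fun y => by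
    rw [opA_eq_opB_add_iff hA, map_zero, map_zero, add_zero]
  have hzero_mem : (0 : L2 Ω) ∈ Uad lo hi := by
    filter_upwards [Lp.coeFn_zero ℝ 2 (vol Ω)] with x hx
    rw [hx]
    exact ⟨hlo, hhi⟩
  have hfeas : (uncontrolledState a c₀ yr, (0 : L2 Ω)) ∈ feasible a c₀ yr lo hi :=
    ⟨(hstate _).2 rfl, hzero_mem⟩
  constructor
  · obtain ⟨y, u⟩ := w
    rintro ⟨⟨hyu, -⟩, hmin⟩
    have hgrowth := (cost_uncontrolledState_add_le hA hβ hβ₀ hyu).trans (hmin _ hfeas)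
    have hu_sq : α / 2 * ‖u‖ ^ 2 = 0 := le_antisymm (by linarith) (by positivity)
    obtain rfl : u = 0 := by simpa [hα.ne'] using hu_sq
    rw [(hstate y).1 hyu]
  · rintro rfl
    refine ⟨hfeas, fun w hw => ?_⟩
    have hquad : 0 ≤ α / 2 * ‖w.2‖ ^ 2 := by positivity
    linarith [cost_uncontrolledState_add_le (α := α) hA hβ hβ₀ hw.1]

end OptimalControl

end SparseControl

open SparseControl in
theorem lemma2p3_general {n : ℕ} {Ω : TopologicalSpace.Opens (Sp n)} [IsFiniteMeasure (vol Ω)]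
    {e : Sp n} (he : ‖e‖ = 1) (hΩ : Bornology.IsBounded (inner ℝ e '' (Ω : Set (Sp n))))
    {a : Fin n → Fin n → Linf Ω} {c₀ : Linf Ω} (hc₀ : ∀ᵐ x ∂vol Ω, 0 ≤ c₀ x)
    {θ : ℝ} (hθ : 0 < θ)
    (ha_ell : ∀ᵐ x ∂vol Ω, ∀ ξ : Sp n, θ * ‖ξ‖ ^ 2 ≤ ∑ i, ∑ j, a i j x * ξ i * ξ j)
    (yd yr : L2 Ω) {lo hi α β : ℝ} (hlo : lo ≤ 0) (hhi : 0 ≤ hi) (hα : 0 < α) (hβ : 0 ≤ β) :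
    (opA a c₀).IsInvertible ∧
      (beta0 a c₀ yd yr ≤ ENNReal.ofReal β →
        ∀ w : H10 Ω × L2 Ω,
          IsSolution a c₀ yd yr lo hi α β w ↔ w = (uncontrolledState a c₀ yr, 0)) :=
  have hA := isInvertible_of_isCoercive (isCoercive_opA he hΩ hc₀ hθ ha_ell)
  ⟨hA, fun hβ₀ _ => isSolution_iff_eq_uncontrolledState hA hlo hhi hα hβ hβ₀⟩

open SparseControl in
theorem lemma2p3 {n : ℕ} (hn : n = 2 ∨ n = 3)
    (Ω : TopologicalSpace.Opens (Sp n)) (hΩ_conv : Convex ℝ (Ω : Set (Sp n)))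
    (hΩ_bdd : Bornology.IsBounded (Ω : Set (Sp n)))
    (a : Fin n → Fin n → Linf Ω) (c₀ : Linf Ω)
    (hc₀ : ∀ᵐ x ∂vol Ω, 0 ≤ c₀ x)
    (ha_symm : ∀ᵐ x ∂vol Ω, ∀ i j, a i j x = a j i x)
    (θ : ℝ) (hθ : 0 < θ)
    (ha_ell : ∀ᵐ x ∂vol Ω, ∀ ξ : Sp n, θ * ‖ξ‖ ^ 2 ≤ ∑ i, ∑ j, a i j x * ξ i * ξ j)
    (yd yr : L2 Ω) (lo hi α β : ℝ) (hlo : lo ≤ 0) (hhi : 0 ≤ hi) (hα : 0 < α) (hβ : 0 < β) :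
    (opA a c₀).IsInvertible ∧
      (beta0 a c₀ yd yr ≤ ENNReal.ofReal β →
        ∀ w : H10 Ω × L2 Ω, IsSolution a c₀ yd yr lo hi α β w ↔ w = (uncontrolledState a c₀ yr, 0)) := by
  have : IsFiniteMeasure (vol Ω) := isFiniteMeasure_restrict.2 hΩ_bdd.measure_lt_top.ne
  let e : Sp n := EuclideanSpace.single ⟨0, by omega⟩ 1
  exact lemma2p3_general (e := e) (by simp [e]) ((innerSL ℝ e).lipschitz.isBounded_image hΩ_bdd)
    hc₀ hθ ha_ell yd yr hlo hhi hα hβ.le
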